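/- Let $Q=(V,E,s,t)$ be a finite quiver (finitely many vertices and edges; loops and multiple edges are allowed) which is connected, i.e. nonempty and connected as an undirected graph. For $m,n\ge 0$ let $B_{m,n}$ be the quiver with distinct vertices $x,v_1,\dots,v_m,w_1,\dots,w_n,y$ whose edges are those of the two directed paths $x\to v_1\to\cdots\to v_m\to y$ and $x\to w_1\to\cdots\to w_n\to y$ (so $B_{0,0}$ consists of two parallel edges from $x$ to $y$). Assume that $Q$ contains no quasi-bigon, i.e. no (not necessarily full) subquiver of $Q$ is isomorphic to any $B_{m,n}$. Let $c(Q)$ be the condensation of $Q$: its vertices are the strongly connected components of $Q$, and for distinct components $X\neq Y$ there is exactly one edge from $X$ to $Y$ if $Q$ has an edge from a vertex of $X$ to a vertex of $Y$, and no edge otherwise; $c(Q)$ has no loops. Let $\mathbf{Path}_{c(Q)}$ be the category freely generated by $c(Q)$, and let $\mathbf{Reach}_Q$ be the category whose objects are the vertices of $Q$, with exactly one morphism $v\to w$ if there is a (possibly empty) directed path from $v$ to $w$ in $Q$, and none otherwise. Then there is a homotopy equivalence of classifying spaces $$|\mathrm{N}(\mathbf{Path}_{c(Q)})|\simeq|\mathrm{N}(\mathbf{Reach}_Q)|,$$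 where $\mathrm N$ is the nerve and $|\cdot|$ the geometric realisation. -/

import Mathlib

open CategoryTheory

universe u v w

namespace QuiverReach

/-- A quiver is connected if it is nonempty and its underlying undirected graph is connected:
any two vertices are joined by a zigzag of edges. -/
def IsConnected (V : Type u) [Quiver.{v} V] : Prop :=
  Nonempty V ∧ ∀ a b : V, Nonempty (Quiver.Path (V := Quiver.Symmetrify V) a b)

/-- A quiver is finite if it has finitely many vertices and finitely many edges. -/
def IsFinite (V : Type u) [Quiver.{v} V] : Prop :=
  Finite V ∧ Finite (Σ a b : V, a ⟶ b)

/-- The vertices of the quiver `B_{m,n}`: two distinct end points `x` and `y`, and the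
intermediate vertices `v 0, …, v (m-1)` and `w 0, …, w (n-1)`. -/
inductive Bigon (m n : ℕ) : Type
  | x : Bigon m n
  | v (i : Fin m) : Bigon m n
  | w (j : Fin n) : Bigon m n
  | y : Bigon m n

namespace Bigon

variable {m n : ℕ}

/-- The vertices `x, v 0, …, v (m-1), y` in the order in which the upper branch visits them. -/
def upper (m n : ℕ) : Fin (m + 2) → Bigon m n :=
  Fin.cons (α := fun _ => Bigon m n) x (Fin.snoc (α := fun _ => Bigon m n) v y)

/-- The vertices `x, w 0, …, w (n-1), y` in the order in which the lower branch visits them. -/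
def lower (m n : ℕ) : Fin (n + 2) → Bigon m n :=
  Fin.cons (α := fun _ => Bigon m n) x (Fin.snoc (α := fun _ => Bigon m n) w y)

/-- The source of an edge. The edges of `B_{m,n}` are the `m + 1` edges of the upper branch and
the `n + 1` edges of the lower branch. -/
def src : Fin (m + 1) ⊕ Fin (n + 1) → Bigon m n
  | .inl i => upper m n i.castSucc
  | .inr j => lower m n j.castSucc

/-- The target of an edge. -/
def tgt : Fin (m + 1) ⊕ Fin (n + 1) → Bigon m n
  | .inl i => upper m n i.succ
  | .inr j => lower m n j.succ

/-- The quiver `B_{m,n}`; for `m = n = 0` it has the two vertices `x`, `y` and two parallel edges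
from `x` to `y`. -/
instance : Quiver.{0} (Bigon m n) where
  Hom a b := {e : Fin (m + 1) ⊕ Fin (n + 1) // src e = a ∧ tgt e = b}

end Bigon

/-- A morphism of quivers that is injective on vertices and on edges, that is, an isomorphism
onto a subquiver of the target. -/
def IsEmbedding {U : Type u} {V : Type v} [Quiver.{w} U] [Quiver V] (φ : U ⥤q V) : Prop :=
  Function.Injective φ.obj ∧
    ∀ a b : U, Function.Injective (fun e : a ⟶ b => φ.map e)

/-- The quiver contains a quasi-bigon: a (not necessarily full) subquiver isomorphic to some
`B_{m,n}` with `m, n ≥ 0`. -/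
def HasQuasiBigon (V : Type u) [Quiver.{v} V] : Prop :=
  ∃ (m n : ℕ) (φ : Bigon m n ⥤q V), IsEmbedding φ

/-- The vertices of the condensation `c(Q)`: the strongly connected components of `Q`. -/
def Condensation (V : Type u) [Quiver.{v} V] : Type u :=
  Quiver.StronglyConnectedComponent V

/-- For two distinct components `X ≠ Y` there is exactly one edge from `X` to `Y` in `c(Q)` if
`Q` has an edge from a vertex of `X` to a vertex of `Y`, and none otherwise; there are no
loops. -/
instance (V : Type u) [Quiver.{v} V] : Quiver.{u} (Condensation V) where
  Hom X Y := ULift.{u} (PLift (X ≠ Y ∧ ∃ a b : V,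
    Quiver.StronglyConnectedComponent.mk a = X ∧
    Quiver.StronglyConnectedComponent.mk b = Y ∧ Nonempty (a ⟶ b)))

/-- The objects of the reachability category of a quiver: its vertices. -/
def Reach (V : Type u) [Quiver.{v} V] : Type u := V

/-- The reachability category: there is exactly one morphism `a ⟶ b` if there is a (possibly
empty) path from `a` to `b`, and none otherwise. -/
instance (V : Type u) [Quiver.{v} V] : Category.{u} (Reach V) where
  Hom a b := ULift.{u} (PLift (Nonempty (Quiver.Path (V := V) a b)))
  id _ := ⟨⟨⟨Quiver.Path.nil⟩⟩⟩
  comp f g := ⟨⟨f.down.down.elim fun p => g.down.down.elim fun q => ⟨p.comp q⟩⟩⟩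

/-- The classifying space of a small category: the geometric realisation of its nerve. -/
noncomputable def ClassifyingSpace (C : Type u) [Category.{v} C] : TopCat.{max u v} :=
  SSet.toTop.obj (nerve C)

end QuiverReach

/-! The two categories are equivalent, and an equivalence of categories induces a homotopy
equivalence of classifying spaces. Choosing a vertex in each component gives a functor
`representative` from paths in the condensation to reachability. It is always full and essentially
surjective; faithfulness says that parallel paths in c(Q) coincide (`subsingleton_path`). Two
distinct simple parallel paths in Q contain a quasi-bigon (`hasQuasiBigon_of_ne`), so simple paths
in Q are unique. Lifting two paths of c(Q) to simple paths in Q with the same ends then forces their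
last edges to agree. Topologically, a natural transformation is a simplicial homotopy, which must be
realised (`homotopic_map`). This needs |Δ[n] ⊗ Δ[1]| ≅ |Δ[n]| × |Δ[1]| only for single prisms: the
resulting maps Δⁿ → C(Δ¹, |Y|) glue over |X|, and uncurrying gives the homotopy. -/

namespace Realization

/-! ### Points of the geometric realisation -/

open Simplicial MonoidalCategory Opposite

/-- The point of the realisation of `X` given by a simplex and barycentric coordinates. -/
noncomputable def point (X : SSet.{u}) {n : ℕ} (x : X _⦋n⦌) (t : stdSimplex ℝ (Fin (n + 1))) :
    SSet.toTop.obj X :=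
  SSet.toTop.map (SSet.yonedaEquiv.symm x) (⦋n⦌.toTopHomeo.symm t)

lemma continuous_point (X : SSet.{u}) {n : ℕ} (x : X _⦋n⦌) : Continuous (point X x) :=
  (SSet.toTop.map (SSet.yonedaEquiv.symm x)).hom.continuous.comp
    (⦋n⦌.toTopHomeo.symm.continuous)

lemma point_map (X : SSet.{u}) {m n : ℕ} (f : ⦋m⦌ ⟶ ⦋n⦌) (x : X _⦋n⦌)
    (t : stdSimplex ℝ (Fin (m + 1))) :
    point X (X.map f.op x) t = point X x (stdSimplex.map f t) := by
  have h : SSet.yonedaEquiv.symm (X.map f.op x) =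
      SSet.stdSimplex.map f ≫ SSet.yonedaEquiv.symm x := by
    apply SSet.yonedaEquiv.injective
    simp [SSet.yonedaEquiv_comp, SSet.yonedaEquiv_map,
      SSet.yonedaEquiv_symm_app_objEquiv_symm.{u}]
  unfold point
  rw [h, Functor.map_comp]
  erw [SimplexCategory.toTopHomeo_symm_naturality_apply]
  rfl

lemma map_point {X Y : SSet.{u}} (g : X ⟶ Y) {n : ℕ} (x : X _⦋n⦌)
    (t : stdSimplex ℝ (Fin (n + 1))) :
    SSet.toTop.map g (point X x t) = point Y (g.app _ x) t := by
  have h : SSet.yonedaEquiv.symm (g.app _ x) = SSet.yonedaEquiv.symm x ≫ g := by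
    apply SSet.yonedaEquiv.injective
    simp
  unfold point
  rw [h, Functor.map_comp]
  rfl

/-- Makes the adjunction between realisation and singular complex usable on points; extensionality
and gluing of maps out of |X| both follow from it. -/
lemma homEquiv_apply {X : SSet.{u}} {Z : TopCat.{u}} (f : SSet.toTop.obj X ⟶ Z) {n : ℕ}
    (x : X _⦋n⦌) (t : stdSimplex ℝ (Fin (n + 1))) :
    Z.toSSetObjEquiv (op ⦋n⦌) ((sSetTopAdj.homEquiv X Z f).app _ x) t = f (point X x t) := by
  rw [Adjunction.homEquiv_unit]
  have := sSetTopAdj_unit_app_app_down X (op ⦋n⦌) x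
  have h2 : f (point X x t) = f ((show SimplexCategory.toTop.{u}.obj ⦋n⦌ ⟶ SSet.toTop.obj X from
      ((sSetTopAdj.unit.app X).app (op ⦋n⦌) x).down) ⟨t⟩) := by
    rw [this]; rfl
  rw [h2]
  rfl

lemma hom_ext {X : SSet.{u}} {Z : TopCat.{u}} {f g : SSet.toTop.obj X ⟶ Z}
    (h : ∀ (n : ℕ) (x : X _⦋n⦌) (t : stdSimplex ℝ (Fin (n + 1))),
      f (point X x t) = g (point X x t)) : f = g := by
  apply (sSetTopAdj.homEquiv X Z).injective
  ext ⟨⟨n⟩⟩ x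
  apply (Z.toSSetObjEquiv _).injective
  ext t
  exact (homEquiv_apply f x t).trans ((h n x t).trans (homEquiv_apply g x t).symm)

/-- A natural family of maps on simplices glues to a map on the realisation. -/
lemma exists_desc (X : SSet.{u}) (Z : TopCat.{u})
    (φ : ∀ {n : ℕ}, X _⦋n⦌ → C(stdSimplex ℝ (Fin (n + 1)), Z))
    (hφ : ∀ {m n : ℕ} (f : ⦋m⦌ ⟶ ⦋n⦌) (x : X _⦋n⦌) (t : stdSimplex ℝ (Fin (m + 1))),
      φ (X.map f.op x) t = φ x (stdSimplex.map f t)) :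
    ∃ F : SSet.toTop.obj X ⟶ Z, ∀ {n : ℕ} (x : X _⦋n⦌) (t : stdSimplex ℝ (Fin (n + 1))),
      F (point X x t) = φ x t := by
  let g : X ⟶ TopCat.toSSet.obj Z :=
    { app := fun n => ↾fun x => (Z.toSSetObjEquiv n).symm (φ (n := n.unop.len) x)
      naturality := by
        rintro ⟨⟨n⟩⟩ ⟨⟨m⟩⟩ f
        ext x
        apply (Z.toSSetObjEquiv _).injective
        ext t
        exact hφ f.unop x t }
  refine ⟨(sSetTopAdj.homEquiv X Z).symm g, fun {n} x t => ?_⟩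
  rw [← homEquiv_apply, Equiv.apply_symm_apply]
  rfl

lemma map_apply {X Y : Type*} [Fintype X] [Fintype Y] [DecidableEq Y] (f : X → Y)
    (s : stdSimplex ℝ X) (y : Y) : stdSimplex.map f s y = ∑ x with f x = y, s x := by
  rw [stdSimplex.map_coe, FunOnFinite.linearMap_apply_apply]

/-- Every point of a simplex lies in the interior of a face. -/
lemma exists_interior {k : ℕ} (v : stdSimplex ℝ (Fin (k + 1))) :
    ∃ (a : ℕ) (f : ⦋a⦌ ⟶ ⦋k⦌) (w : stdSimplex ℝ (Fin (a + 1))),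
      (∀ i, 0 < w i) ∧ stdSimplex.map f w = v := by
  classical
  let A : Finset (Fin (k + 1)) := {i | v i ≠ 0}
  have hA : A.Nonempty := by
    by_contra h
    rw [Finset.not_nonempty_iff_eq_empty, Finset.filter_eq_empty_iff] at h
    have := stdSimplex.sum_eq_one v
    rw [Finset.sum_eq_zero (fun i hi => not_not.1 (h hi))] at this
    exact zero_ne_one this
  obtain ⟨a, ha⟩ : ∃ a, A.card = a + 1 :=
    Nat.exists_eq_succ_of_ne_zero (Finset.card_ne_zero.2 hA)
  let e := A.orderEmbOfFin ha
  have hsum : ∀ y, ∑ x with e x = y, v (e x) = v y := by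
    intro y
    by_cases hy : v y = 0
    · rw [hy]
      exact Finset.sum_eq_zero fun x hx => by rw [(Finset.mem_filter.1 hx).2, hy]
    · have : y ∈ Set.range e := by
        rw [Finset.range_orderEmbOfFin]; simpa [A] using hy
      obtain ⟨z, rfl⟩ := this
      rw [Finset.sum_eq_single z]
      · intro b hb hbz
        exact absurd (e.injective (Finset.mem_filter.1 hb).2) hbz
      · intro hz; simp at hz
  refine ⟨a, SimplexCategory.mkHom e.toOrderHom, ⟨fun i => v (e i), fun i => v.2.1 _, ?_⟩, ?_, ?_⟩
  · rw [← stdSimplex.sum_eq_one v, ← Finset.sum_congr rfl (fun y _ => hsum y)]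
    exact (Finset.sum_fiberwise Finset.univ e (fun x => v (e x))).symm
  · intro i
    have : v (e i) ≠ 0 := by
      exact (Finset.mem_filter.1 (A.orderEmbOfFin_mem ha i)).2
    exact lt_of_le_of_ne (v.2.1 _) this.symm
  · apply stdSimplex.ext
    funext y
    exact (map_apply _ _ y).trans (hsum y)

/-- Pass to the face whose interior contains the point, then write that face as a degeneracy of a
nondegenerate simplex. The degeneracy is surjective, so it keeps all coordinates positive. -/
lemma exists_nonDegenerate_point {X : SSet.{u}} {k : ℕ} (c : X _⦋k⦌)
    (v : stdSimplex ℝ (Fin (k + 1))) :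
    ∃ (a b : ℕ) (f : ⦋a⦌ ⟶ ⦋k⦌) (g : ⦋a⦌ ⟶ ⦋b⦌) (y : X.nonDegenerate b)
      (w : stdSimplex ℝ (Fin (a + 1))), (∀ i, 0 < stdSimplex.map g w i) ∧
      stdSimplex.map f w = v ∧ X.map f.op c = X.map g.op y.1 := by
  obtain ⟨a, f, w, hw, rfl⟩ := exists_interior v
  obtain ⟨b, g, hg, y, hy⟩ := X.exists_nonDegenerate (X.map f.op c)
  refine ⟨a, b, f, g, y, w, fun i => ?_, rfl, hy⟩
  rw [map_apply]
  obtain ⟨j, hj⟩ := SimplexCategory.epi_iff_surjective.1 hg i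
  exact Finset.sum_pos (fun x _ => hw x) ⟨j, Finset.mem_filter.2 ⟨Finset.mem_univ _, hj⟩⟩

/-! ### Points of |Δ[p] ⊗ Δ[q]| as measures supported on chains -/

section Product

variable {p q : ℕ}

/-- The weights on the vertices of `Δ[p] ⊗ Δ[q]` of a point of a simplex. -/
noncomputable def weight {k : ℕ} (c : (Δ[p] ⊗ Δ[q] : SSet.{u}) _⦋k⦌)
    (v : stdSimplex ℝ (Fin (k + 1))) : stdSimplex ℝ (Fin (p + 1) × Fin (q + 1)) :=
  stdSimplex.map (SSet.prodStdSimplex.objEquiv c) v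

lemma weight_map {k l : ℕ} (c : (Δ[p] ⊗ Δ[q] : SSet.{u}) _⦋k⦌) (f : ⦋l⦌ ⟶ ⦋k⦌)
    (v : stdSimplex ℝ (Fin (l + 1))) :
    weight ((Δ[p] ⊗ Δ[q] : SSet.{u}).map f.op c) v = weight c (stdSimplex.map f v) := by
  unfold weight
  rw [stdSimplex.map_comp_apply]
  rfl

lemma exists_normalForm {k : ℕ} (c : (Δ[p] ⊗ Δ[q] : SSet.{u}) _⦋k⦌)
    (v : stdSimplex ℝ (Fin (k + 1))) :
    ∃ (b : ℕ) (y : (Δ[p] ⊗ Δ[q] : SSet.{u}) _⦋b⦌) (w : stdSimplex ℝ (Fin (b + 1))),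
      StrictMono (SSet.prodStdSimplex.objEquiv y) ∧ (∀ i, 0 < w i) ∧
      point _ c v = point _ y w ∧ weight c v = weight y w := by
  obtain ⟨a, b, f, g, y, w, hw, rfl, h⟩ := exists_nonDegenerate_point c v
  refine ⟨b, y.1, stdSimplex.map g w,
    (SSet.prodStdSimplex.nonDegenerate_iff_strictMono_objEquiv _).1 y.2, hw, ?_, ?_⟩
  · rw [← point_map, ← point_map, h]
  · rw [← weight_map, ← weight_map, h]

lemma weight_ne_zero_iff {b : ℕ} {y : (Δ[p] ⊗ Δ[q] : SSet.{u}) _⦋b⦌}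
    {w : stdSimplex ℝ (Fin (b + 1))} (hw : ∀ i, 0 < w i) (z : Fin (p + 1) × Fin (q + 1)) :
    weight y w z ≠ 0 ↔ z ∈ Set.range (SSet.prodStdSimplex.objEquiv y) := by
  unfold weight
  rw [map_apply]
  constructor
  · intro h
    obtain ⟨i, hi, -⟩ := Finset.exists_ne_zero_of_sum_ne_zero h
    exact ⟨i, (Finset.mem_filter.1 hi).2⟩
  · rintro ⟨i, hi⟩
    exact (Finset.sum_pos (fun x _ => hw x) ⟨i, by simpa using hi⟩).ne'

lemma weight_apply_of_injective {b : ℕ} {y : (Δ[p] ⊗ Δ[q] : SSet.{u}) _⦋b⦌}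
    (hy : Function.Injective (SSet.prodStdSimplex.objEquiv y)) (w : stdSimplex ℝ (Fin (b + 1)))
    (i : Fin (b + 1)) : weight y w (SSet.prodStdSimplex.objEquiv y i) = w i := by
  unfold weight
  rw [map_apply, Finset.sum_eq_single i]
  · intro j hj hji
    exact absurd (hy (Finset.mem_filter.1 hj).2) hji
  · intro hi; simp at hi

/-- Points of `|Δ[p] ⊗ Δ[q]|` are determined by their weights. -/
lemma point_eq_of_weight_eq {k k' : ℕ} {c : (Δ[p] ⊗ Δ[q] : SSet.{u}) _⦋k⦌}
    {c' : (Δ[p] ⊗ Δ[q] : SSet.{u}) _⦋k'⦌} {v : stdSimplex ℝ (Fin (k + 1))}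
    {v' : stdSimplex ℝ (Fin (k' + 1))} (h : weight c v = weight c' v') :
    point _ c v = point _ c' v' := by
  obtain ⟨b, y, w, hy, hw, h1, h2⟩ := exists_normalForm c v
  obtain ⟨b', y', w', hy', hw', h1', h2'⟩ := exists_normalForm c' v'
  rw [h1, h1']
  rw [h2, h2'] at h
  -- In normal form the support of the weights is the chain of vertices, and a strictly monotone map
  -- is determined by its range.
  have hr : Set.range (SSet.prodStdSimplex.objEquiv y) =
      Set.range (SSet.prodStdSimplex.objEquiv y') := by
    ext z
    rw [← weight_ne_zero_iff hw, ← weight_ne_zero_iff hw', h]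
  obtain rfl : b = b' := by
    have := congrArg Set.ncard hr
    rw [← Set.image_univ, ← Set.image_univ, Set.ncard_image_of_injective _ hy.injective,
      Set.ncard_image_of_injective _ hy'.injective] at this
    simpa [Set.ncard_univ] using this
  obtain rfl : y = y' := by
    apply SSet.prodStdSimplex.objEquiv.injective
    ext1
    exact (StrictMono.range_inj hy hy').1 hr
  congr 1
  apply stdSimplex.ext
  funext i
  rw [← weight_apply_of_injective hy.injective w i, h, weight_apply_of_injective hy.injective]

lemma sum_map {X Y : Type*} [Fintype X] [Fintype Y] (f : X → Y) (v : stdSimplex ℝ X)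
    (P : Y → Prop) [DecidablePred P] :
    ∑ y with P y, stdSimplex.map f v y = ∑ x with P (f x), v x := by
  classical
  simp_rw [map_apply]
  rw [← Finset.sum_fiberwise_of_maps_to (s := {x | P (f x)}) (t := {y | P y}) (g := f)
    (fun x hx => by simpa using hx)]
  refine Finset.sum_congr rfl fun y hy => Finset.sum_congr ?_ fun _ _ => rfl
  ext x
  simp only [Finset.mem_filter, Finset.mem_univ, true_and] at hy ⊢
  constructor
  · rintro rfl; exact ⟨hy, rfl⟩
  · exact fun h => h.2

/-- For a measure supported on a chain, the mass of a product of lower sets is the minimum of the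
masses of the factors. -/
lemma sum_lower {k : ℕ} (f : Fin (k + 1) →o Fin (p + 1) × Fin (q + 1))
    (v : stdSimplex ℝ (Fin (k + 1))) {P : Fin (p + 1) → Prop} {Q : Fin (q + 1) → Prop}
    [DecidablePred P] [DecidablePred Q] (hP : ∀ a b, a ≤ b → P b → P a)
    (hQ : ∀ a b, a ≤ b → Q b → Q a) :
    ∑ i with P (f i).1 ∧ Q (f i).2, v i = min (∑ i with P (f i).1, v i) (∑ i with Q (f i).2, v i) := by
  have hmono : ∀ {R S : Fin (k + 1) → Prop} [DecidablePred R] [DecidablePred S], (∀ i, R i → S i) →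
      ∑ i with R i, v i ≤ ∑ i with S i, v i := fun {R S} _ _ h =>
    Finset.sum_le_sum_of_subset_of_nonneg (fun i hi => by simp at hi ⊢; exact h i hi)
      fun i _ _ => v.2.1 i
  -- Both conditions pull back along `f` to initial segments of a linear order, so one contains the
  -- other.
  by_cases hc : ∀ i, P (f i).1 → Q (f i).2
  · rw [min_eq_left (hmono hc)]
    congr 1; ext i; simp; exact hc i
  · push Not at hc
    obtain ⟨j, hj, hj'⟩ := hc
    have hc : ∀ i, Q (f i).2 → P (f i).1 := fun i hi => by
      rcases le_total i j with h | h
      · exact hP _ _ (f.monotone h).1 hj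
      · exact absurd (hQ _ _ (f.monotone h).2 hi) hj'
    rw [min_eq_right (hmono hc)]
    congr 1; ext i; simp; exact hc i

end Product

/-! ### Decomposition of the prism -/

section Prism

variable {n : ℕ}

lemma sum_fst_lt_add (μ : Fin (n + 1) × Fin (1 + 1) → ℝ) (i : Fin (n + 1)) :
    ∑ z with z.1 ≤ i ∧ z.2 ≤ 0, μ z = μ (i, 0) + ∑ z with z.1 < i ∧ z.2 ≤ 0, μ z := by
  rw [← Finset.sum_insert (by simp)]
  congr 1
  ext ⟨a, b⟩
  simp only [Finset.mem_filter, Finset.mem_univ, true_and, Finset.mem_insert, Prod.mk.injEq]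
  rw [Fin.le_zero_iff, le_iff_lt_or_eq]
  tauto

/-- A measure supported on a chain is determined by its marginals: `sum_lower` gives its mass on
products of lower sets, and differences of these give the mass of each point. -/
lemma weight_ext {k k' : ℕ} {c : (Δ[n] ⊗ Δ[1] : SSet.{u}) _⦋k⦌}
    {c' : (Δ[n] ⊗ Δ[1] : SSet.{u}) _⦋k'⦌} {v : stdSimplex ℝ (Fin (k + 1))}
    {v' : stdSimplex ℝ (Fin (k' + 1))}
    (h₁ : stdSimplex.map c.1 v = stdSimplex.map c'.1 v')
    (h₂ : stdSimplex.map c.2 v = stdSimplex.map c'.2 v') : weight c v = weight c' v' := by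
  have key : ∀ (P : Fin (n + 1) → Prop) [DecidablePred P], (∀ a b, a ≤ b → P b → P a) →
      ∑ z with P z.1 ∧ z.2 ≤ 0, weight c v z = ∑ z with P z.1 ∧ z.2 ≤ 0, weight c' v' z := by
    intro P _ hP
    have hQ : ∀ a b : Fin (1 + 1), a ≤ b → b ≤ 0 → a ≤ 0 := fun a b h h' => h.trans h'
    unfold weight
    refine (sum_map (SSet.prodStdSimplex.objEquiv c) v (fun z => P z.1 ∧ z.2 ≤ 0)).trans
      (Eq.trans ?_ (sum_map (SSet.prodStdSimplex.objEquiv c') v' (fun z => P z.1 ∧ z.2 ≤ 0)).symm)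
    refine (sum_lower (SSet.prodStdSimplex.objEquiv c) v hP hQ).trans
      (Eq.trans ?_ (sum_lower (SSet.prodStdSimplex.objEquiv c') v' hP hQ).symm)
    congr 1
    · refine (sum_map c.1 v P).symm.trans (Eq.trans ?_ (sum_map c'.1 v' P))
      rw [h₁]
    · refine (sum_map c.2 v (· ≤ 0)).symm.trans (Eq.trans ?_ (sum_map c'.2 v' (· ≤ 0)))
      rw [h₂]
  have h0 : ∀ i, weight c v (i, 0) = weight c' v' (i, 0) := by
    intro i
    have e₁ := key (· ≤ i) (fun a b h h' => h.trans h')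
    have e₂ := key (· < i) (fun a b h h' => h.trans_lt h')
    rw [sum_fst_lt_add, sum_fst_lt_add, e₂] at e₁
    exact add_right_cancel e₁
  have fib : ∀ {k : ℕ} (c : (Δ[n] ⊗ Δ[1] : SSet.{u}) _⦋k⦌) (v : stdSimplex ℝ (Fin (k + 1))) i,
      stdSimplex.map c.1 v i = weight c v (i, 0) + weight c v (i, 1) := by
    intro k c v i
    have : stdSimplex.map c.1 v = stdSimplex.map Prod.fst (weight c v) :=
      (stdSimplex.map_comp_apply (SSet.prodStdSimplex.objEquiv c) Prod.fst v).symm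
    rw [this, map_apply, ← Finset.sum_pair (f := weight c v) (by simp)]
    congr 1
    ext ⟨a, b⟩
    fin_cases b <;> simp
  apply stdSimplex.ext
  funext ⟨i, b⟩
  fin_cases b
  · exact h0 i
  · have := fib c v i
    rw [h₁, fib c' v' i, h0 i] at this
    exact (add_left_cancel this).symm

/-- The maximal nondegenerate simplices of `Δ[n] ⊗ Δ[1]`. -/
def prismSimplex (i : Fin (n + 1)) : (Δ[n] ⊗ Δ[1] : SSet.{u}) _⦋n + 1⦌ :=
  SSet.prodStdSimplex.objEquiv.symm
    -- The chain (0,0), …, (i,0), (i,1), …, (n,1), which changes level over vertex `i`.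
    { toFun := fun j => (i.predAbove j, if j ≤ i.castSucc then 0 else 1)
      monotone' := fun a b h => ⟨Fin.predAbove_right_monotone i h, by
        dsimp only
        split_ifs with h1 h2 h2
        exacts [le_rfl, Fin.zero_le _, absurd (h.trans h2) h1, le_rfl]⟩ }

/-- Otherwise, by induction, every partial sum of `t` would stay below `s`, whereas the full sum is
1. -/
lemma exists_break (t : stdSimplex ℝ (Fin (n + 1))) {s : ℝ} (h0 : 0 ≤ s) (h1 : s ≤ 1) :
    ∃ i : Fin (n + 1), ∑ j with j < i, t j ≤ s ∧ s ≤ ∑ j with j < i, t j + t i := by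
  have hs : ∀ i : Fin (n + 1), ∑ j with j < i, t j + t i = ∑ j with j ≤ i, t j := by
    intro i
    rw [add_comm, ← Finset.sum_insert (by simp)]
    congr 1
    ext j; simp [le_iff_lt_or_eq, or_comm]
  simp_rw [hs]
  by_contra! h
  have : ∀ i : Fin (n + 1), ∑ j with j ≤ i, t j < s := by
    intro i
    induction i using Fin.induction with
    | zero => exact h 0 (by simpa using h0)
    | succ i ih =>
      apply h
      refine le_trans (le_of_eq ?_) ih.le
      congr 1
      ext j
      simp [Fin.lt_def, Fin.le_def]
  have := this (Fin.last n)
  simp [Fin.le_last] at this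
  have h2 := stdSimplex.sum_eq_one t
  linarith

lemma exists_prismSimplex (t : stdSimplex ℝ (Fin (n + 1))) (s : stdSimplex ℝ (Fin 2)) :
    ∃ (i : Fin (n + 1)) (v : stdSimplex ℝ (Fin (n + 2))),
      stdSimplex.map (prismSimplex.{u} i).1 v = t ∧ stdSimplex.map (prismSimplex.{u} i).2 v = s := by
  obtain ⟨i, hi, hi'⟩ := exists_break t (s.2.1 0) (stdSimplex.le_one s 0)
  -- Level 0 must carry mass `s 0`: it takes all of `t j` for `j < i` and the part `x` of `t i`; the
  -- remaining `t i - x` sits at (i,1).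
  set x : ℝ := s 0 - ∑ j with j < i, t j with hx
  have hx0 : 0 ≤ x := sub_nonneg.2 hi
  have hx1 : 0 ≤ t i - x := by
    have : s.1 0 = s 0 := rfl
    linarith
  let r : Fin (n + 1) → ℝ := fun j => t j - if j = i then x else 0
  -- Index `i.castSucc` is the vertex (i,0). The other indices are `succAbove j`, with `j = i`
  -- giving (i,1).
  let v : Fin (n + 2) → ℝ := i.castSucc.insertNth (α := fun _ => ℝ) x r
  have hr : ∀ j, 0 ≤ r j := by
    intro j
    dsimp [r]
    split_ifs with h
    · rw [h]; exact hx1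
    · rw [sub_zero]; exact t.2.1 j
  have hv : v ∈ stdSimplex ℝ (Fin (n + 2)) := by
    constructor
    · intro j
      refine Fin.succAboveCases i.castSucc ?_ ?_ j
      · simp [v, hx0]
      · intro j; simp [v, hr j]
    · rw [Fin.sum_univ_succAbove _ i.castSucc]
      simp [v, r]
  have hv1 : stdSimplex.map (prismSimplex.{u} i).1 ⟨v, hv⟩ = t := by
    apply stdSimplex.ext
    funext k
    rw [map_apply, Finset.sum_filter, Fin.sum_univ_succAbove _ i.castSucc]
    change (if i.predAbove i.castSucc = k then v i.castSucc else 0) +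
      ∑ j, (if i.predAbove (i.castSucc.succAbove j) = k then v (i.castSucc.succAbove j) else 0) = t k
    simp [v, r, eq_comm]
  refine ⟨i, ⟨v, hv⟩, hv1, ?_⟩
  have hv2 : stdSimplex.map (prismSimplex.{u} i).2 ⟨v, hv⟩ 0 = s 0 := by
    rw [map_apply, Finset.sum_filter, Fin.sum_univ_succAbove _ i.castSucc]
    change (if (if i.castSucc ≤ i.castSucc then (0 : Fin 2) else 1) = 0 then v i.castSucc else 0) +
      ∑ j, (if (if i.castSucc.succAbove j ≤ i.castSucc then (0 : Fin 2) else 1) = 0 then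
        v (i.castSucc.succAbove j) else 0) = s 0
    have : ∀ j, (if (if i.castSucc.succAbove j ≤ i.castSucc then (0 : Fin 2) else 1) = 0 then
        v (i.castSucc.succAbove j) else 0) = if j < i then t j else 0 := by
      intro j
      rcases lt_or_ge j i with h | h
      · rw [if_pos h]
        have : i.castSucc.succAbove j ≤ i.castSucc := by
          rw [Fin.succAbove_of_castSucc_lt _ _ (by simpa using h)]; simpa using h.le
        rw [if_pos (by rw [if_pos this]),
          show v (i.castSucc.succAbove j) = r j from Fin.insertNth_apply_succAbove _ _ _ _]
        show t j - (if j = i then x else 0) = t j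
        rw [if_neg h.ne, sub_zero]
      · rw [if_neg h.not_gt]
        have : ¬ i.castSucc.succAbove j ≤ i.castSucc := by
          rw [Fin.succAbove_of_le_castSucc _ _ (by simpa using h)]
          exact not_le.2 (Nat.lt_succ_of_le h)
        rw [if_neg (by rw [if_neg this]; exact one_ne_zero)]
    rw [Finset.sum_congr rfl (fun j _ => this j), ← Finset.sum_filter, if_pos (by rw [if_pos le_rfl])]
    rw [show v i.castSucc = x from Fin.insertNth_apply_same _ _ _]
    exact sub_add_cancel _ _
  apply stdSimplex.ext
  funext b
  have h1 := stdSimplex.add_eq_one s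
  have h2 := stdSimplex.add_eq_one (stdSimplex.map (prismSimplex.{u} i).2 ⟨v, hv⟩)
  fin_cases b
  · exact hv2
  · change stdSimplex.map (prismSimplex.{u} i).2 ⟨v, hv⟩ 1 = s 1
    linarith

end Prism

/-! ### Comparison of |Δ[n] ⊗ Δ[1]| with |Δ[n]| × |Δ[1]| -/

/-- The coordinates in `|Δ[n]| × |Δ[1]|` of a point of a simplex of `Δ[n] ⊗ Δ[1]`. -/
noncomputable def coords {n k : ℕ} (c : (Δ[n] ⊗ Δ[1] : SSet.{u}) _⦋k⦌)
    (v : stdSimplex ℝ (Fin (k + 1))) : stdSimplex ℝ (Fin (n + 1)) × stdSimplex ℝ (Fin 2) :=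
  (stdSimplex.map c.1 v, stdSimplex.map c.2 v)

lemma continuous_coords {n k : ℕ} (c : (Δ[n] ⊗ Δ[1] : SSet.{u}) _⦋k⦌) :
    Continuous (coords c) :=
  (stdSimplex.continuous_map _).prodMk (stdSimplex.continuous_map _)

lemma coords_prismSimplex_surjective (n : ℕ) : Function.Surjective
    (fun z : Fin (n + 1) × stdSimplex ℝ (Fin (n + 2)) => coords (prismSimplex.{u} z.1) z.2) := by
  rintro ⟨t, s⟩
  obtain ⟨i, v, h₁, h₂⟩ := exists_prismSimplex.{u} t s
  exact ⟨(i, v), Prod.ext h₁ h₂⟩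

lemma continuous_coords_prismSimplex (n : ℕ) : Continuous
    (fun z : Fin (n + 1) × stdSimplex ℝ (Fin (n + 2)) => coords (prismSimplex.{u} z.1) z.2) := by
  rw [continuous_prod_of_discrete_left]
  exact fun a => continuous_coords (prismSimplex a)

/-- A continuous surjection from a compact space to a Hausdorff space is closed, hence a quotient
map. Continuity of `prismFun` can thus be tested on each maximal simplex. -/
lemma isQuotientMap_coords (n : ℕ) : Topology.IsQuotientMap
    (fun z : Fin (n + 1) × stdSimplex ℝ (Fin (n + 2)) => coords (prismSimplex.{u} z.1) z.2) := by
  have hc := continuous_coords_prismSimplex.{u} n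
  have hs := coords_prismSimplex_surjective.{u} n
  exact hc.isClosedMap.isQuotientMap hc hs

lemma point_eq_of_coords_eq {n k k' : ℕ} {c : (Δ[n] ⊗ Δ[1] : SSet.{u}) _⦋k⦌}
    {c' : (Δ[n] ⊗ Δ[1] : SSet.{u}) _⦋k'⦌} {v : stdSimplex ℝ (Fin (k + 1))}
    {v' : stdSimplex ℝ (Fin (k' + 1))} (h : coords c v = coords c' v') :
    point _ c v = point _ c' v' :=
  point_eq_of_weight_eq (weight_ext (congrArg Prod.fst h) (congrArg Prod.snd h))

/-- The inverse of the comparison map `|Δ[n] ⊗ Δ[1]| → |Δ[n]| × |Δ[1]|`. -/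
noncomputable def prismFun (n : ℕ) (z : stdSimplex ℝ (Fin (n + 1)) × stdSimplex ℝ (Fin 2)) :
    SSet.toTop.obj (Δ[n] ⊗ Δ[1] : SSet.{u}) :=
  let w := Function.surjInv (coords_prismSimplex_surjective.{u} n) z
  point _ (prismSimplex w.1) w.2

/-- The arbitrary choice in `prismFun` is harmless, since coordinates determine the point of the
realisation. -/
lemma prismFun_coords {n k : ℕ} (c : (Δ[n] ⊗ Δ[1] : SSet.{u}) _⦋k⦌)
    (v : stdSimplex ℝ (Fin (k + 1))) : prismFun n (coords c v) = point _ c v :=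
  point_eq_of_coords_eq (Function.surjInv_eq (coords_prismSimplex_surjective.{u} n) (coords c v))

lemma continuous_prismFun (n : ℕ) : Continuous (prismFun.{u} n) := by
  rw [(isQuotientMap_coords.{u} n).continuous_iff, continuous_prod_of_discrete_left]
  intro a
  exact (continuous_point _ (prismSimplex a)).congr fun w =>
    (prismFun_coords (prismSimplex a) w).symm

/-! ### Realisation of simplicial homotopies -/

section

variable {X Y : SSet.{u}} (H : X ⊗ Δ[1] ⟶ Y)

lemma map_whiskerRight_point {n k : ℕ} (x : X _⦋n⦌) (c : (Δ[n] ⊗ Δ[1] : SSet.{u}) _⦋k⦌)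
    (v : stdSimplex ℝ (Fin (k + 1))) :
    SSet.toTop.map (SSet.yonedaEquiv.symm x ▷ Δ[1] ≫ H) (point _ c v) =
      point Y (H.app (op ⦋k⦌) (X.map (SSet.stdSimplex.objEquiv c.1).op x, c.2)) v := by
  rw [map_point]
  rfl

/-- The homotopy given on a simplex by a map out of a simplicial cylinder. -/
noncomputable def cylinder {n : ℕ} (x : X _⦋n⦌) :
    C(stdSimplex ℝ (Fin (n + 1)), C(stdSimplex ℝ (Fin 2), SSet.toTop.obj Y)) :=
  ContinuousMap.curry
    ((SSet.toTop.map (SSet.yonedaEquiv.symm x ▷ Δ[1] ≫ H)).hom.comp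
      ⟨prismFun n, continuous_prismFun n⟩)

lemma cylinder_coords {n k : ℕ} (x : X _⦋n⦌) (c : (Δ[n] ⊗ Δ[1] : SSet.{u}) _⦋k⦌)
    (v : stdSimplex ℝ (Fin (k + 1))) :
    cylinder H x (coords c v).1 (coords c v).2 =
      point Y (H.app (op ⦋k⦌) (X.map (SSet.stdSimplex.objEquiv c.1).op x, c.2)) v := by
  rw [← map_whiskerRight_point, ← prismFun_coords]
  rfl

/-- The compatibility needed for gluing. Every point of the prism over Δ[m] lies on some
`prismSimplex`, whose image in the prism over Δ[n] has the required coordinates. -/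
lemma cylinder_map {m n : ℕ} (f : ⦋m⦌ ⟶ ⦋n⦌) (x : X _⦋n⦌) (t : stdSimplex ℝ (Fin (m + 1))) :
    cylinder H (X.map f.op x) t = cylinder H x (stdSimplex.map f t) := by
  ext s
  obtain ⟨⟨i, v⟩, h⟩ := coords_prismSimplex_surjective.{u} m (t, s)
  let c : (Δ[m] ⊗ Δ[1] : SSet.{u}) _⦋m + 1⦌ := prismSimplex i
  have h₁ : (coords c v).1 = t := congrArg Prod.fst h
  have h₂ : (coords c v).2 = s := congrArg Prod.snd h
  let c' : (Δ[n] ⊗ Δ[1] : SSet.{u}) _⦋m + 1⦌ := (SSet.stdSimplex.map f ▷ Δ[1]).app _ c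
  have h₁' : (coords c' v).1 = stdSimplex.map f t := by
    rw [← h₁]
    exact (stdSimplex.map_comp_apply c.1 f v).symm
  have h₂' : (coords c' v).2 = s := h₂
  rw [← h₁', ← h₁]
  nth_rewrite 1 [← h₂]
  rw [← h₂', cylinder_coords, cylinder_coords, ← CategoryTheory.Functor.map_comp_apply X]
  rfl

lemma cylinder_const {n : ℕ} (x : X _⦋n⦌) (t : stdSimplex ℝ (Fin (n + 1))) (b : Fin 2) :
    cylinder H x t (stdSimplex.vertex b) =
      point Y (H.app (op ⦋n⦌) (x, SSet.stdSimplex.const 1 b (op ⦋n⦌))) t := by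
  let c : (Δ[n] ⊗ Δ[1] : SSet.{u}) _⦋n⦌ :=
    (SSet.stdSimplex.objEquiv.symm (𝟙 _), SSet.stdSimplex.const 1 b (op ⦋n⦌))
  have h₁ : (coords c t).1 = t := stdSimplex.map_id_apply t
  have h₂ : (coords c t).2 = stdSimplex.vertex b := by
    apply stdSimplex.ext
    funext a
    refine (map_apply _ _ _).trans ?_
    have : ∀ i, c.2 i = b := fun i => rfl
    by_cases h : b = a
    · subst h
      simp [this]
    · simp [this, h]
  have := cylinder_coords H x c t
  rw [h₁, h₂] at this
  rw [this]
  congr 3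
  exact CategoryTheory.Functor.map_id_apply X _ x

/-- A simplicial homotopy induces a homotopy of geometric realisations. -/
theorem homotopic_map :
    ((SSet.toTop.map (SSet.ι₀ ≫ H)).hom).Homotopic (SSet.toTop.map (SSet.ι₁ ≫ H)).hom := by
  -- Gluing with values in the mapping space avoids describing the topology of |X| × Δ¹; local
  -- compactness of Δ¹ later permits uncurrying.
  obtain ⟨F, hF⟩ := exists_desc X (TopCat.of C(stdSimplex ℝ (Fin 2), SSet.toTop.obj Y))
    (cylinder H) (cylinder_map H)
  have hend : ∀ b, ∀ g : X ⟶ Y, (∀ n (x : X _⦋n⦌),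
      g.app (op ⦋n⦌) x = H.app (op ⦋n⦌) (x, SSet.stdSimplex.const 1 b (op ⦋n⦌))) →
      ∀ p, F p (stdSimplex.vertex b) = SSet.toTop.map g p := by
    intro b g hg p
    let ev : SSet.toTop.obj X ⟶ SSet.toTop.obj Y :=
      TopCat.ofHom ⟨fun p => F p (stdSimplex.vertex b), by
        exact (continuous_eval_const (F := C(stdSimplex ℝ (Fin 2), SSet.toTop.obj Y)) _).comp F.hom.continuous⟩
    have : ev = SSet.toTop.map g := hom_ext fun n x t => by
      rw [map_point, hg, ← cylinder_const, ← hF]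
      rfl
    exact congrArg (fun f : SSet.toTop.obj X ⟶ SSet.toTop.obj Y => f p) this
  have hu : Continuous fun z : SSet.toTop.obj X × stdSimplex ℝ (Fin 2) =>
      (F z.1 : C(stdSimplex ℝ (Fin 2), SSet.toTop.obj Y)) z.2 :=
    ContinuousMap.continuous_uncurry_of_continuous F.hom
  refine ⟨⟨⟨fun z => (F z.2 : C(stdSimplex ℝ (Fin 2), SSet.toTop.obj Y))
    (stdSimplexHomeomorphUnitInterval.symm z.1), ?_⟩, fun p => ?_, fun p => ?_⟩⟩
  · exact hu.comp (continuous_snd.prodMk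
      (stdSimplexHomeomorphUnitInterval.symm.continuous.comp continuous_fst))
  · have : stdSimplexHomeomorphUnitInterval.symm 0 = stdSimplex.vertex 0 := by
      rw [Homeomorph.symm_apply_eq]; exact stdSimplexHomeomorphUnitInterval_zero.symm
    change F p (stdSimplexHomeomorphUnitInterval.symm 0) = _
    rw [this]
    exact hend 0 (SSet.ι₀ ≫ H) (fun _ _ => rfl) p
  · have : stdSimplexHomeomorphUnitInterval.symm 1 = stdSimplex.vertex 1 := by
      rw [Homeomorph.symm_apply_eq]; exact stdSimplexHomeomorphUnitInterval_one.symm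
    change F p (stdSimplexHomeomorphUnitInterval.symm 1) = _
    rw [this]
    exact hend 1 (SSet.ι₁ ≫ H) (fun _ _ => rfl) p

end

/-! ### Natural transformations and nerves -/

section Nerve

variable {C D : Type u} [Category.{v} C] [Category.{v} D]

/-- The simplicial homotopy between nerves induced by a natural transformation. -/
def nerveHomotopy {F G : C ⥤ D} (α : F ⟶ G) : nerve C ⊗ Δ[1] ⟶ nerve D where
  app n := ↾fun z =>
    -- A simplex of the cylinder is a functor [n] → C × [1], composed here with the functor C × [1]
    -- → D encoding `α`.
    (show ComposableArrows C n.unop.len from z.1).prod'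
      (SSet.stdSimplex.objEquiv z.2).toOrderHom.monotone.functor ⋙
      (Functor.uncurry.obj ((ComposableArrows.mk₁ α).flip))
  naturality _ _ _ := rfl

lemma ι₀_nerveHomotopy {F G : C ⥤ D} (α : F ⟶ G) : SSet.ι₀ ≫ nerveHomotopy α = nerveMap F := by
  ext ⟨⟨n⟩⟩ x
  refine CategoryTheory.Functor.ext (fun i => rfl) fun i j f => ?_
  change F.map (x.map f) ≫ 𝟙 _ = 𝟙 _ ≫ F.map (x.map f) ≫ 𝟙 _
  simp

lemma ι₁_nerveHomotopy {F G : C ⥤ D} (α : F ⟶ G) : SSet.ι₁ ≫ nerveHomotopy α = nerveMap G := by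
  ext ⟨⟨n⟩⟩ x
  refine CategoryTheory.Functor.ext (fun i => rfl) fun i j f => ?_
  change G.map (x.map f) ≫ 𝟙 _ = 𝟙 _ ≫ G.map (x.map f) ≫ 𝟙 _
  simp

lemma homotopic_nerveMap {F G : C ⥤ D} (α : F ⟶ G) :
    (SSet.toTop.map (nerveMap F)).hom.Homotopic (SSet.toTop.map (nerveMap G)).hom := by
  have := homotopic_map (nerveHomotopy α)
  rwa [ι₀_nerveHomotopy, ι₁_nerveHomotopy] at this

/-- Equivalent categories have homotopy equivalent classifying spaces. -/
theorem nonempty_homotopyEquiv (e : C ≌ D) :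
    Nonempty (ContinuousMap.HomotopyEquiv (QuiverReach.ClassifyingSpace C)
      (QuiverReach.ClassifyingSpace D)) := by
  refine ⟨⟨(SSet.toTop.map (nerveMap e.functor)).hom, (SSet.toTop.map (nerveMap e.inverse)).hom,
    ?_, ?_⟩⟩
  · have := homotopic_nerveMap e.unitIso.inv
    have h : nerveMap (e.functor ⋙ e.inverse) = nerveMap e.functor ≫ nerveMap e.inverse := rfl
    have h' : nerveMap (𝟭 C) = 𝟙 (nerve C) := rfl
    rw [h, h', CategoryTheory.Functor.map_comp, CategoryTheory.Functor.map_id] at this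
    exact this
  · have := homotopic_nerveMap e.counitIso.hom
    have h : nerveMap (e.inverse ⋙ e.functor) = nerveMap e.inverse ≫ nerveMap e.functor := rfl
    have h' : nerveMap (𝟭 D) = 𝟙 (nerve D) := rfl
    rw [h, h', CategoryTheory.Functor.map_comp, CategoryTheory.Functor.map_id] at this
    exact this

end Nerve

end Realization

/-! ### Recognising quasi-bigons -/

namespace QuiverReach

namespace Bigon

variable {V : Type u} {m n : ℕ}

/-- The map on vertices determined by the sequences of vertices on the two branches. -/
def vertexMap (a : Fin (m + 2) → V) (b : Fin (n + 2) → V) : Bigon m n → V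
  | x => a 0
  | v i => a i.succ.castSucc
  | w j => b j.succ.castSucc
  | y => a (Fin.last _)

lemma vertexMap_upper (a : Fin (m + 2) → V) (b : Fin (n + 2) → V) (k : Fin (m + 2)) :
    vertexMap a b (upper m n k) = a k := by
  refine Fin.cases rfl (fun k => ?_) k
  refine Fin.lastCases ?_ (fun k => ?_) k
  · simp [upper, vertexMap]
  · simp [upper, vertexMap]

lemma vertexMap_lower (a : Fin (m + 2) → V) (b : Fin (n + 2) → V) (h0 : a 0 = b 0)
    (hl : a (Fin.last _) = b (Fin.last _)) (k : Fin (n + 2)) :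
    vertexMap a b (lower m n k) = b k := by
  refine Fin.cases h0 (fun k => ?_) k
  refine Fin.lastCases ?_ (fun k => ?_) k
  · simp [lower, vertexMap, hl]
  · simp [lower, vertexMap]

lemma vertexMap_injective {a : Fin (m + 2) → V} {b : Fin (n + 2) → V}
    (ha : Function.Injective a) (hb : Function.Injective b)
    (hz : a 0 = b 0) (hl : a (Fin.last _) = b (Fin.last _))
    (hab : ∀ i j, a i = b j → i = 0 ∨ i = Fin.last _) : Function.Injective (vertexMap a b) := by
  have h0 : ∀ {k : ℕ} (i : Fin k), i.succ.castSucc ≠ 0 := fun i => by simp [Fin.ext_iff]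
  have h1 : ∀ {k : ℕ} (i : Fin k), i.succ.castSucc ≠ Fin.last _ := fun i => Fin.castSucc_ne_last _
  have h2 : ∀ {k : ℕ}, (0 : Fin (k + 2)) ≠ Fin.last _ := fun h => by simp [Fin.ext_iff] at h
  have ha' : ∀ i j : Fin m, a i.succ.castSucc = a j.succ.castSucc → i = j := fun i j h =>
    Fin.succ_injective _ (Fin.castSucc_injective _ (ha h))
  have hb' : ∀ i j : Fin n, b i.succ.castSucc = b j.succ.castSucc → i = j := fun i j h =>
    Fin.succ_injective _ (Fin.castSucc_injective _ (hb h))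
  have hvw : ∀ (i : Fin m) (j : Fin n), a i.succ.castSucc ≠ b j.succ.castSucc := fun i j h =>
    (hab _ _ h).elim (h0 i) (h1 i)
  have hxw : ∀ j : Fin n, a 0 ≠ b j.succ.castSucc := fun j h => h0 j (hb (h.symm.trans hz))
  have hyw : ∀ j : Fin n, a (Fin.last _) ≠ b j.succ.castSucc := fun j h =>
    h1 j (hb (h.symm.trans hl))
  rintro (_ | i | j | _) (_ | i' | j' | _) h <;> simp only [vertexMap] at h
  · rfl
  · exact absurd (ha h).symm (h0 _)
  · exact absurd h (hxw _)
  · exact absurd (ha h) h2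
  · exact absurd (ha h) (h0 _)
  · rw [ha' _ _ h]
  · exact absurd h (hvw _ _)
  · exact absurd (ha h) (h1 _)
  · exact absurd h.symm (hxw _)
  · exact absurd h.symm (hvw _ _)
  · rw [hb' _ _ h]
  · exact absurd h.symm (hyw _)
  · exact absurd (ha h).symm h2
  · exact absurd (ha h).symm (h1 _)
  · exact absurd h (hyw _)
  · rfl

end Bigon

/-- Two sequences of composable edges with common end points and otherwise disjoint form a
quasi-bigon. -/
lemma hasQuasiBigon_of_sequences {V : Type u} [Quiver.{v} V] {m n : ℕ}
    {a : Fin (m + 2) → V} {b : Fin (n + 2) → V}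
    (ha : Function.Injective a) (hb : Function.Injective b)
    (h0 : a 0 = b 0) (hl : a (Fin.last _) = b (Fin.last _))
    (hab : ∀ i j, a i = b j → i = 0 ∨ i = Fin.last _)
    (ea : ∀ i : Fin (m + 1), a i.castSucc ⟶ a i.succ)
    (eb : ∀ j : Fin (n + 1), b j.castSucc ⟶ b j.succ)
    (hne : ∀ i j, (⟨_, _, ea i⟩ : Σ s t : V, s ⟶ t) ≠ ⟨_, _, eb j⟩) : HasQuasiBigon V := by
  -- Bundling edges with their ends allows comparison across hom-types. Within a branch, edges
  -- differ because their sources do.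
  let S : Fin (m + 1) ⊕ Fin (n + 1) → Σ s t : V, s ⟶ t :=
    Sum.elim (fun i => ⟨_, _, ea i⟩) (fun j => ⟨_, _, eb j⟩)
  have hS : Function.Injective S := by
    rintro (i | i) (j | j) h
    · exact congrArg Sum.inl (Fin.castSucc_injective _ (ha (congrArg Sigma.fst h)))
    · exact absurd h (hne i j)
    · exact absurd h.symm (hne j i)
    · exact congrArg Sum.inr (Fin.castSucc_injective _ (hb (congrArg Sigma.fst h)))
  have hsrc : ∀ e, (S e).1 = Bigon.vertexMap a b (Bigon.src e) := by
    rintro (i | j)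
    · exact (Bigon.vertexMap_upper a b _).symm
    · exact (Bigon.vertexMap_lower a b h0 hl _).symm
  have htgt : ∀ e, (S e).2.1 = Bigon.vertexMap a b (Bigon.tgt e) := by
    rintro (i | j)
    · exact (Bigon.vertexMap_upper a b _).symm
    · exact (Bigon.vertexMap_lower a b h0 hl _).symm
  let φ : Bigon m n ⥤q V :=
    { obj := Bigon.vertexMap a b
      map := fun e => (S e.1).2.2.cast ((hsrc e.1).trans (congrArg _ e.2.1))
        ((htgt e.1).trans (congrArg _ e.2.2)) }
  refine ⟨m, n, φ, Bigon.vertexMap_injective ha hb h0 hl hab, fun s t e e' h => ?_⟩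
  have key : ∀ e : s ⟶ t, S e.1 = ⟨_, _, φ.map e⟩ := fun e => by
    refine Sigma.ext ((hsrc e.1).trans (congrArg _ e.2.1)) ?_
    have : ∀ (z : Σ s t : V, s ⟶ t) (s t : V) (h : z.1 = s) (h' : z.2.1 = t),
        z.2 ≍ (⟨t, z.2.2.cast h h'⟩ : Σ t : V, s ⟶ t) := by
      rintro ⟨s, t, f⟩ _ _ rfl rfl
      rfl
    exact this _ _ _ _ _
  apply Subtype.ext
  apply hS
  rw [key e, key e']
  exact congrArg (fun f => (⟨_, _, f⟩ : Σ s t : V, s ⟶ t)) h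

/-! ### Simple paths in a quiver -/

section Paths

open Quiver

variable {V : Type u} [Quiver.{v} V]

/-- The edge is typed by entries of the vertex list, as `hasQuasiBigon_of_sequences` requires; the
factorisation recovers the path when it has a single edge. -/
lemma exists_edge {x y : V} (p : Path x y) {i : ℕ} (hi : i < p.length) :
    ∃ (e : p.vertices[i]'(by simp; omega) ⟶ p.vertices[i + 1]'(by simp; omega))
      (p₁ : Path x _) (p₂ : Path _ y), p = (p₁.cons e).comp p₂ ∧ p₁.length = i := by
  obtain ⟨v, P, p₂, hp, hl⟩ := p.exists_eq_comp_of_le_length (n := i + 1) hi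
  cases P with
  | nil => simp at hl
  | @cons u _ p₁ e =>
    have hl' : p₁.length = i := by simpa using hl
    have h₁ : p.vertices[i]'(by simp; omega) = u := by
      have hp' : p = p₁.comp (e.toPath.comp p₂) := by
        rw [hp, ← Path.comp_assoc, Path.comp_toPath_eq_cons]
      subst hp' hl'
      exact Path.vertices_comp_get_length_eq p₁ _
    have h₂ : p.vertices[i + 1]'(by simp; omega) = v := by
      subst hp hl'
      exact Path.vertices_comp_get_length_eq (p₁.cons e) p₂
    generalize p.vertices[i]'(by simp; omega) = u' at h₁
    generalize p.vertices[i + 1]'(by simp; omega) = v' at h₂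
    subst h₁ h₂
    exact ⟨e, p₁, p₂, hp, hl'⟩

lemma hasQuasiBigon_of_disjoint {x y : V} {p q : Path x y} (hp : p.vertices.Nodup)
    (hq : q.vertices.Nodup) (hpq : p ≠ q) (hxy : x ≠ y)
    (hdisj : ∀ z ∈ p.vertices, z ∈ q.vertices → z = x ∨ z = y) : HasQuasiBigon V := by
  obtain ⟨m, hm⟩ : ∃ m, p.length = m + 1 :=
    Nat.exists_eq_succ_of_ne_zero fun h => hxy (Path.eq_of_length_zero p h)
  obtain ⟨n, hn⟩ : ∃ n, q.length = n + 1 :=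
    Nat.exists_eq_succ_of_ne_zero fun h => hxy (Path.eq_of_length_zero q h)
  have hpl : p.vertices.length = m + 2 := by simp [hm]
  have hql : q.vertices.length = n + 2 := by simp [hn]
  choose ea p₁ p₂ hp₁ hp₁' using fun i : Fin (m + 1) => exists_edge p (i := i) (by omega)
  choose eb q₁ q₂ hq₁ hq₁' using fun i : Fin (n + 1) => exists_edge q (i := i) (by omega)
  have hplast : p.vertices[m + 1] = y := by
    have := p.vertices_getLast
    rw [List.getLast_eq_getElem] at this
    simpa [hm] using this
  have hqlast : q.vertices[n + 1] = y := by
    have := q.vertices_getLast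
    rw [List.getLast_eq_getElem] at this
    simpa [hn] using this
  have hend : ∀ i (hi : i < m + 2) j (hj : j < n + 2), p.vertices[i] = q.vertices[j] →
      (i = 0 ∧ j = 0) ∨ (i = m + 1 ∧ j = n + 1) := by
    intro i hi j hj h
    rcases hdisj _ (List.getElem_mem (by omega)) (h ▸ List.getElem_mem (l := q.vertices) _) with h' | h'
    · left
      constructor
      · exact (hp.getElem_inj_iff (hj := by omega)).1 (h'.trans p.getElem_vertices_zero.symm)
      · exact (hq.getElem_inj_iff (hj := by omega)).1
          ((h.symm.trans h').trans q.getElem_vertices_zero.symm)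
    · right
      constructor
      · exact (hp.getElem_inj_iff (hj := by omega)).1 (h'.trans hplast.symm)
      · exact (hq.getElem_inj_iff (hj := by omega)).1 ((h.symm.trans h').trans hqlast.symm)
  refine hasQuasiBigon_of_sequences (m := m) (n := n) (a := fun i => p.vertices[i.1])
    (b := fun j => q.vertices[j.1]) ?_ ?_ ?_ ?_ ?_ ea eb ?_
  · intro i j h
    exact Fin.ext ((hp.getElem_inj_iff).1 h)
  · intro i j h
    exact Fin.ext ((hq.getElem_inj_iff).1 h)
  · exact p.getElem_vertices_zero.trans q.getElem_vertices_zero.symm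
  · exact hplast.trans hqlast.symm
  · intro i j h
    rcases hend i i.2 j j.2 h with h | h
    · exact Or.inl (Fin.ext h.1)
    · exact Or.inr (Fin.ext h.1)
  -- A common edge has common source and target, which must be `x` and `y`. Both paths then consist
  -- of this one edge, contradicting `p ≠ q`.
  · intro i j h
    have hs := congrArg Sigma.fst h
    have ht := congrArg (fun z => z.2.1) h
    have hs' := hend i (by omega) j (by omega) hs
    have ht' := hend (i + 1) (by omega) (j + 1) (by omega) ht
    have hi : i.1 = 0 := by omega
    have hj : j.1 = 0 := by omega
    have e₁ := congrArg Path.length (hp₁ i)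
    have e₂ := congrArg Path.length (hq₁ j)
    simp only [Path.length_comp, Path.length_cons] at e₁ e₂
    apply hpq
    have : ∀ {s t s' t' : V} (e : s ⟶ t) (e' : s' ⟶ t') (p₁ : Path x s) (p₂ : Path t y)
        (q₁ : Path x s') (q₂ : Path t' y), (⟨_, _, e⟩ : Σ s t : V, s ⟶ t) = ⟨_, _, e'⟩ →
        p₁.length = 0 → p₂.length = 0 → q₁.length = 0 → q₂.length = 0 →
        (p₁.cons e).comp p₂ = (q₁.cons e').comp q₂ := by
      rintro s t s' t' e e' p₁ p₂ q₁ q₂ h h1 h2 h3 h4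
      cases h
      obtain rfl := Path.eq_of_length_zero p₁ h1
      obtain rfl := Path.eq_of_length_zero p₂ h2
      rw [(Path.length_eq_zero_iff _).1 h1, (Path.length_eq_zero_iff _).1 h2,
        (Path.length_eq_zero_iff _).1 h3, (Path.length_eq_zero_iff _).1 h4]
    rw [hp₁ i, hq₁ j]
    exact this _ _ _ _ _ _ h (by rw [hp₁', hi]) (by omega) (by rw [hq₁', hj]) (by omega)

lemma nodup_of_comp {x y z : V} {p : Path x y} {q : Path y z} (h : (p.comp q).vertices.Nodup) :
    p.vertices.Nodup ∧ q.vertices.Nodup := by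
  rw [Path.vertices_comp] at h
  refine ⟨?_, h.of_append_right⟩
  rw [← p.dropLast_append_end_eq]
  exact h.sublist ((List.singleton_sublist.2 q.start_mem_vertices).append_left _)

lemma eq_nil_of_nodup {x : V} {p : Path x x} (h : p.vertices.Nodup) : p = Path.nil := by
  cases p with
  | nil => rfl
  | cons p e =>
    rw [Path.vertices_cons, List.concat_eq_append, List.nodup_append] at h
    exact absurd rfl (h.2.2 _ p.start_mem_vertices x (by simp))

/-- Two distinct simple paths with the same end points produce a quasi-bigon. -/
lemma hasQuasiBigon_of_ne {x y : V} {p q : Path x y} (hp : p.vertices.Nodup)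
    (hq : q.vertices.Nodup) (hpq : p ≠ q) : HasQuasiBigon V := by
  induction hN : p.length + q.length using Nat.strong_induction_on generalizing x y with
  | _ N ih =>
    by_cases hxy : x = y
    · subst hxy
      exact absurd ((eq_nil_of_nodup hp).trans (eq_nil_of_nodup hq).symm) hpq
    by_cases hdisj : ∀ z ∈ p.vertices, z ∈ q.vertices → z = x ∨ z = y
    · exact hasQuasiBigon_of_disjoint hp hq hpq hxy hdisj
    push Not at hdisj
    -- Cut both paths at a common interior vertex `z`: the initial or the final pieces still differ,
    -- and they are shorter.
    obtain ⟨z, hzp, hzq, hzx, hzy⟩ := hdisj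
    obtain ⟨p₁, p₂, rfl⟩ := p.exists_eq_comp_of_mem_vertices hzp
    obtain ⟨q₁, q₂, rfl⟩ := q.exists_eq_comp_of_mem_vertices hzq
    have h1 : p₁.length ≠ 0 := fun h => hzx (Path.eq_of_length_zero p₁ h).symm
    have h2 : p₂.length ≠ 0 := fun h => hzy (Path.eq_of_length_zero p₂ h)
    simp only [Path.length_comp] at hN
    by_cases h : p₁ = q₁
    · exact ih _ (by omega) (nodup_of_comp hp).2 (nodup_of_comp hq).2
        (fun h' => hpq (by rw [h, h'])) rfl
    · exact ih _ (by omega) (nodup_of_comp hp).1 (nodup_of_comp hq).1 h rfl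

/-- Loop erasure: if the new endpoint was already visited, truncate the path there. -/
lemma exists_nodup_path {x y : V} (p : Path x y) : ∃ q : Path x y, q.vertices.Nodup := by
  induction p with
  | nil => exact ⟨Path.nil, by simp⟩
  | @cons b c p e ih =>
    obtain ⟨q, hq⟩ := ih
    by_cases hc : c ∈ q.vertices
    · obtain ⟨q₁, q₂, rfl⟩ := q.exists_eq_comp_of_mem_vertices hc
      exact ⟨q₁, (nodup_of_comp hq).1⟩
    · refine ⟨q.cons e, ?_⟩
      rw [Path.vertices_cons, List.concat_eq_append]
      exact hq.append (by simp) (by simpa using hc)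

lemma path_of_mem_vertices {x y z : V} {p : Path x y} (hz : z ∈ p.vertices) :
    Nonempty (Path x z) ∧ Nonempty (Path z y) := by
  obtain ⟨p₁, p₂, -⟩ := p.exists_eq_comp_of_mem_vertices hz
  exact ⟨⟨p₁⟩, ⟨p₂⟩⟩

end Paths

/-! ### Paths in the condensation and reachability -/

section Condensation

open Quiver

variable {V : Type u} [Quiver.{v} V]

/-- The strongly connected component of a vertex, as a vertex of the condensation. -/
def component (a : V) : Condensation V := StronglyConnectedComponent.mk a

lemma component_eq_iff {a b : V} :
    component a = component b ↔ Nonempty (Path a b) ∧ Nonempty (Path b a) :=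
  StronglyConnectedComponent.mk_eq_mk

lemma component_surjective : Function.Surjective (component : V → Condensation V) :=
  Quotient.exists_rep

/-- A simple path ending with a prescribed passage into the last component. -/
lemma exists_nodup_path_through {x a b y : V} (hxa : Nonempty (Path x a)) (f : a ⟶ b)
    (hab : component a ≠ component b) (hy : component y = component b) :
    ∃ p : Path x y, p.vertices.Nodup ∧ a ∈ p.vertices ∧
      ∀ z ∈ p.vertices, Nonempty (Path z a) ∨ component z = component y := by
  obtain ⟨p₁, hp₁⟩ := exists_nodup_path hxa.some
  obtain ⟨p₂, hp₂⟩ := exists_nodup_path (component_eq_iff.1 hy).2.some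
  have hv : ((p₁.cons f).comp p₂).vertices = p₁.vertices ++ p₂.vertices := by simp
  refine ⟨(p₁.cons f).comp p₂, ?_, ?_, ?_⟩
  · rw [hv]
    -- A vertex common to both pieces would give a path from `b` back to `a`, putting them in one
    -- component.
    refine hp₁.append hp₂ fun z hz hz' => hab (component_eq_iff.2 ⟨⟨f.toPath⟩, ?_⟩)
    exact ⟨(path_of_mem_vertices hz').1.some.comp (path_of_mem_vertices hz).2.some⟩
  · rw [hv]
    exact List.mem_append_left _ p₁.end_mem_vertices
  · intro z hz
    rw [hv, List.mem_append] at hz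
    rcases hz with hz | hz
    · exact Or.inl (path_of_mem_vertices hz).2
    · refine Or.inr (component_eq_iff.2 ⟨(path_of_mem_vertices hz).2, ?_⟩)
      exact ⟨(component_eq_iff.1 hy).1.some.comp (path_of_mem_vertices hz).1.some⟩

lemma Condensation.exists_edge {X Y : Condensation V} (e : X ⟶ Y) :
    X ≠ Y ∧ ∃ a b : V, component a = X ∧ component b = Y ∧ Nonempty (a ⟶ b) :=
  e.down.down

instance (X Y : Condensation V) : Subsingleton (X ⟶ Y) :=
  inferInstanceAs (Subsingleton (ULift (PLift _)))

/-- Each edge of the condensation lifts to an edge of Q; strong connectivity bridges the gaps inside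
components. -/
lemma path_of_path_component {X Y : Condensation V} (P : Path X Y) {x y : V}
    (hx : component x = X) (hy : component y = Y) : Nonempty (Path x y) := by
  induction P generalizing y with
  | nil => exact (component_eq_iff.1 (hx.trans hy.symm)).1
  | cons P e ih =>
    obtain ⟨-, a, b, ha, hb, ⟨f⟩⟩ := Condensation.exists_edge e
    exact ⟨((ih ha).some.cons f).comp (component_eq_iff.1 (hb.trans hy.symm)).1.some⟩

lemma path_component_of_path {x y : V} (p : Path x y) {X Y : Condensation V}
    (hx : component x = X) (hy : component y = Y) : Nonempty (Path X Y) := by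
  subst hx hy
  induction p with
  | nil => exact ⟨Path.nil⟩
  | @cons b c p e ih =>
    by_cases h : component b = component c
    · rwa [← h]
    · exact ⟨ih.some.cons ⟨⟨h, b, c, rfl, rfl, ⟨e⟩⟩⟩⟩

lemma isEmpty_path_of_hom {X Y : Condensation V} (e : X ⟶ Y) : IsEmpty (Path Y X) := by
  refine ⟨fun P => ?_⟩
  obtain ⟨hne, a, b, ha, hb, ⟨f⟩⟩ := Condensation.exists_edge e
  refine hne ?_
  rw [← ha, ← hb, component_eq_iff]
  exact ⟨⟨f.toPath⟩, path_of_path_component P hb ha⟩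

/-- Without quasi-bigons, paths in the condensation are determined by their end points. -/
lemma subsingleton_path (hV : ¬ HasQuasiBigon V) {X Y : Condensation V} (P P' : Path X Y) :
    P = P' := by
  induction P with
  | nil =>
    cases P' with
    | nil => rfl
    | cons P' e' => exact (isEmpty_path_of_hom e').elim P'
  | @cons Z Y P e ih =>
    cases P' with
    | nil => exact (isEmpty_path_of_hom e).elim P
    | @cons Z' _ P' e' =>
      -- Simple lifts ending with passages through `a` and `a'` coincide. Neither vertex lies in the
      -- last component, so on this one path each reaches the other.
      obtain rfl : Z = Z' := by
        obtain ⟨hne, a, b, rfl, hb, ⟨f⟩⟩ := Condensation.exists_edge e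
        obtain ⟨hne', a', b', rfl, rfl, ⟨f'⟩⟩ := Condensation.exists_edge e'
        obtain ⟨x, rfl⟩ := component_surjective X
        rw [← hb] at hne
        obtain ⟨p, hp, hap, hpa⟩ := exists_nodup_path_through
          (path_of_path_component P rfl rfl) f hne hb.symm
        obtain ⟨q, hq, haq, hqa⟩ := exists_nodup_path_through
          (path_of_path_component P' rfl rfl) f' hne' rfl
        obtain rfl : p = q := by
          by_contra h
          exact hV (hasQuasiBigon_of_ne hp hq h)
        rw [component_eq_iff]
        exact ⟨(hqa a hap).resolve_right (hb ▸ hne), (hpa a' haq).resolve_right hne'⟩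
      rw [ih P', Subsingleton.elim e e']

/-- The functor sending a component to a chosen vertex in it. -/
noncomputable def representative (V : Type u) [Quiver.{v} V] :
    Paths (Condensation.{u, v} V) ⥤ Reach.{u, v} V :=
  Paths.lift
    { obj := fun X => (component_surjective X).choose
      map := fun {X Y} e => ⟨⟨path_of_path_component e.toPath
        (component_surjective X).choose_spec (component_surjective Y).choose_spec⟩⟩ }

instance (a b : Reach V) : Subsingleton (a ⟶ b) :=
  inferInstanceAs (Subsingleton (ULift (PLift _)))

lemma component_representative (X : Condensation V) :
    component (V := V) ((representative V).obj X) = X :=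
  (component_surjective X).choose_spec

instance : (representative V).Full where
  map_surjective {X Y} f := by
    obtain ⟨P⟩ := path_component_of_path f.down.down.some
      (component_representative X) (component_representative Y)
    exact ⟨P, Subsingleton.elim _ _⟩

instance : (representative V).EssSurj where
  mem_essImage a := by
    have h := component_eq_iff.1 (component_representative (component (V := V) a))
    exact ⟨component (V := V) a, ⟨⟨⟨⟨h.1⟩⟩, ⟨⟨h.2⟩⟩, Subsingleton.elim _ _, Subsingleton.elim _ _⟩⟩⟩

/-- Only faithfulness depends on the absence of quasi-bigons. -/
lemma isEquivalence_representative (hV : ¬ HasQuasiBigon V) :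
    (representative V).IsEquivalence where
  faithful := ⟨fun {_ _} P P' _ => subsingleton_path hV P P'⟩

end Condensation

end QuiverReach

theorem mainTheorem5 (V : Type u) [Quiver.{v} V]
    (hfin : QuiverReach.IsFinite V) (hconn : QuiverReach.IsConnected V)
    (hbigon : ¬ QuiverReach.HasQuasiBigon V) :
    Nonempty (ContinuousMap.HomotopyEquiv
      (QuiverReach.ClassifyingSpace (CategoryTheory.Paths (QuiverReach.Condensation V)))
      (QuiverReach.ClassifyingSpace (QuiverReach.Reach V))) := by
  have := QuiverReach.isEquivalence_representative hbigon
  exact Realization.nonempty_homotopyEquiv (QuiverReach.representative V).asEquivalence
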